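/- Let $X, Y, K \subset \mathbb{R}^d$ be compact, let $\mu$ be a Borel probability measure on $X$ and $\nu$ a Borel probability measure on $Y$. Assume that $\mu$ is concentrated on $K$, that $\mu(\partial K)=0$, and that $\mu$ is absolutely continuous with respect to the Lebesgue measure $\mathcal{L}^d$ (the case $X=K$ is included). Let $c(x,y)=h(x-y)$, where $h\in C^1(\mathbb{R}^d)$ is real-valued and strictly convex. For $V\in C(Y)$ and a Borel measurable map $T:X\to Y$ put $$\mathcal{L}(V,T)=\int_X \bigl(c(x,T(x))-V(T(x))\bigr)\,d\mu(x)+\int_Y V(y)\,d\nu(y).$$ A pair $(V^*,T_{\mathrm{rec}})$, with $V^*\in C(Y)$ and $T_{\mathrm{rec}}:X\to Y$ Borel measurable, is called an optimal max--min pair if $$V^*\in\operatorname*{arg\,max}_{V\in C(Y)}\ \inf_{T:X\to Y}\mathcal{L}(V,T)\qquad\text{and}\qquad T_{\mathrm{rec}}\in\operatorname*{arg\,min}_{T:X\to Y}\mathcal{L}(V^*,T),$$ where $T$ ranges over the Borel measurable maps $X\to Y$. An optimal transport map from $\mu$ to $\nu$ is a Borel measurable map $T:X\to Y$ that minimizes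 $\int_X c(x,T(x))\,d\mu(x)$ among all Borel measurable maps with $T_\#\mu=\nu$. Then there is an optimal transport map $T_{\mathrm{opt}}$ from $\mu$ to $\nu$, it is unique up to $\mu$-a.e. equality, and every optimal max--min pair $(V^*,T_{\mathrm{rec}})$ satisfies $$T_{\mathrm{rec}}(x)=T_{\mathrm{opt}}(x)\qquad\text{for }\mu\text{-a.e. }x.$$ -/

import Mathlib

open MeasureTheory Set

noncomputable section

section SemiDual

variable {X Y : Type*} [MeasurableSpace X] [TopologicalSpace Y] [MeasurableSpace Y]

/-- The semi-dual neural optimal transport objective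
`L(V, T) = ∫_X (c(x, T x) - V (T x)) dμ(x) + ∫_Y V(y) dν(y)`. -/
def snotObjective (c : X → Y → ℝ) (μ : Measure X) (ν : Measure Y) (V : C(Y, ℝ)) (T : X → Y) : ℝ :=
  (∫ x, (c x (T x) - V (T x)) ∂μ) + ∫ y, V y ∂ν

/-- The inner value `inf_T L(V, T)`, the infimum being over all measurable maps `T : X → Y`.
It is taken in the extended reals, so that no boundedness convention intervenes. -/
def snotInnerValue (c : X → Y → ℝ) (μ : Measure X) (ν : Measure Y) (V : C(Y, ℝ)) : EReal :=
  ⨅ (T : X → Y) (_ : Measurable T), (snotObjective c μ ν V T : EReal)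

/-- `T` is an optimal recovery map for the potential `V`:
it is a measurable map and minimizes `L(V, ·)` among measurable maps. -/
def IsRecoveryMap (c : X → Y → ℝ) (μ : Measure X) (ν : Measure Y) (V : C(Y, ℝ)) (T : X → Y) :
    Prop :=
  Measurable T ∧ ∀ S : X → Y, Measurable S → snotObjective c μ ν V T ≤ snotObjective c μ ν V S

/-- `(V, T)` is an optimal solution of the max-min problem `sup_V inf_T L(V, T)`:
`V` maximizes the inner value over `C(Y)`, and `T` minimizes `L(V, ·)`. -/
def IsOptimalMaxMinPair (c : X → Y → ℝ) (μ : Measure X) (ν : Measure Y)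
    (V : C(Y, ℝ)) (T : X → Y) : Prop :=
  (∀ W : C(Y, ℝ), snotInnerValue c μ ν W ≤ snotInnerValue c μ ν V) ∧ IsRecoveryMap c μ ν V T

end SemiDual

/-- `T` is an optimal transport (Monge) map from `μ` to `ν` for the cost `c`: it is measurable with
`T_# μ = ν`, and it minimizes the transport cost among all such maps. -/
def IsOptimalTransportMap {X Y : Type*} [MeasurableSpace X] [MeasurableSpace Y]
    (c : X → Y → ℝ) (μ : Measure X) (ν : Measure Y) (T : X → Y) : Prop :=
  MeasurePreserving T μ ν ∧
    ∀ S : X → Y, MeasurePreserving S μ ν → ∫ x, c x (T x) ∂μ ≤ ∫ x, c x (S x) ∂μ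

/-- The translation-invariant cost `c(x, y) = h(x - y)` on `X × Y`, for subsets `X, Y` of `ℝ^d`. -/
def diffCost {d : ℕ} (h : EuclideanSpace ℝ (Fin d) → ℝ) (X Y : Set (EuclideanSpace ℝ (Fin d)))
    (x : X) (y : Y) : ℝ :=
  h ((x : EuclideanSpace ℝ (Fin d)) - (y : EuclideanSpace ℝ (Fin d)))

end

open Filter Topology

/-! This is Kantorovich duality with almost everywhere uniqueness of minimizers. For any `V`, the
transform `V^c` is locally Lipschitz, hence differentiable a.e. by Rademacher; at such a point every
minimizer `y` has `Dh(x - y) = DV^c(x)`, and strict convexity makes `Dh` injective, so `y` is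
determined (`ae_eq_of_eq_cTransform`). Uniqueness makes the minimizers measurably selectable, so the
inner infimum equals `∫ V^c dμ + ∫ V dν`. A maximizer exists by Arzelà–Ascoli, and the first
variation at any maximizer says that its a.e. minimizing map pushes `μ` to `ν`
(`measurePreserving_of_forall_semiDual_le`). Weak duality makes that map optimal, and complementary
slackness forces every optimal map to agree with it. -/

/-- The `c`-transform `V^c(x) = inf_y (c(x, y) - V(y))`. -/
noncomputable def cTransform {X Y : Type*} [TopologicalSpace Y] (c : X → Y → ℝ) (V : C(Y, ℝ)) (x : X) : ℝ := ⨅ y, (c x y - V y)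

/-! ### The `c`-transform and measurable selection of minimizers -/

section Transform

variable {X Y : Type*} [TopologicalSpace Y] [CompactSpace Y] {c : X → Y → ℝ}

theorem exists_eq_cTransform [Nonempty Y] (hc : ∀ x, Continuous (c x)) (V : C(Y, ℝ)) (x : X) :
    ∃ y, c x y - V y = cTransform c V x := by
  obtain ⟨y, -, hy⟩ := isCompact_univ.exists_isMinOn univ_nonempty
    ((hc x).sub V.continuous).continuousOn
  have hy' : ∀ z, c x y - V y ≤ c x z - V z := fun z => hy (mem_univ z)
  exact ⟨y, le_antisymm (le_ciInf hy') (ciInf_le ⟨_, forall_mem_range.2 hy'⟩ y)⟩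

theorem cTransform_le (hc : ∀ x, Continuous (c x)) (V : C(Y, ℝ)) (x : X) (y : Y) :
    cTransform c V x ≤ c x y - V y :=
  ciInf_le (isCompact_range ((hc x).sub V.continuous)).bddBelow y

theorem cTransform_sub_le [Nonempty Y] (hc : ∀ x, Continuous (c x)) (V W : C(Y, ℝ)) (x : X) :
    cTransform c V x - cTransform c W x ≤ ‖V - W‖ := by
  obtain ⟨y, hy⟩ := exists_eq_cTransform hc W x
  have h₁ := cTransform_le hc V x y
  have h₂ := (abs_le.1 ((V - W).norm_coe_le_norm y)).1
  simp only [ContinuousMap.sub_apply] at h₂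
  linarith

theorem abs_cTransform_sub_le [Nonempty Y] (hc : ∀ x, Continuous (c x)) (V W : C(Y, ℝ)) (x : X) :
    |cTransform c V x - cTransform c W x| ≤ ‖V - W‖ := by
  refine abs_sub_le_iff.2 ⟨cTransform_sub_le hc V W x, ?_⟩
  rw [norm_sub_rev]
  exact cTransform_sub_le hc W V x

theorem continuous_cTransform [TopologicalSpace X] (hc : Continuous (Function.uncurry c))
    (V : C(Y, ℝ)) : Continuous (cTransform c V) := by
  have h : Continuous (Function.HasUncurry.uncurry fun x y => c x y - V y) :=
    hc.sub (V.continuous.comp continuous_snd)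
  have := isCompact_univ.continuous_sInf h
  simp only [image_univ] at this
  exact this

/-- Almost minimizers of `c(x, ·) - V` at a point with a unique minimizer converge to it. -/
theorem tendsto_of_tendsto_cTransform [TopologicalSpace X] {ι : Type*} {l : Filter ι}
    (hc : Continuous (Function.uncurry c)) {V : C(Y, ℝ)} {x : ι → X} {u : ι → Y} {x₀ : X} {y₀ : Y}
    (hx : Tendsto x l (𝓝 x₀))
    (hu : Tendsto (fun i => c (x i) (u i) - V (u i)) l (𝓝 (cTransform c V x₀)))
    (huniq : ∀ y, c x₀ y - V y = cTransform c V x₀ → y = y₀) : Tendsto u l (𝓝 y₀) := by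
  -- As `Y` is compact, it suffices that every cluster point of `u` is a minimizer at `x₀`.
  refine tendsto_nhds_of_unique_mapClusterPt fun y hy => huniq y ?_
  obtain ⟨U, hU, hUy⟩ := mapClusterPt_iff_ultrafilter.1 hy
  refine tendsto_nhds_unique ?_ (hu.mono_left hU)
  have h : Continuous fun p : X × Y => c p.1 p.2 - V p.2 :=
    hc.sub (V.continuous.comp continuous_snd)
  exact (h.tendsto (x₀, y)).comp ((hx.mono_left hU).prodMk_nhds hUy)

/-- If the minimizers of `c(x, ·) - V` are almost everywhere unique, they can be selected
measurably. -/
theorem exists_measurable_eq_cTransform [Nonempty Y] [TopologicalSpace X] [MeasurableSpace X]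
    [OpensMeasurableSpace X] [MeasurableSpace Y] [BorelSpace Y] {μ : Measure X}
    (hc : Continuous (Function.uncurry c)) (V : C(Y, ℝ))
    (huniq : ∀ᵐ x ∂μ, {y | c x y - V y = cTransform c V x}.Subsingleton) :
    ∃ T : X → Y, Measurable T ∧ ∀ᵐ x ∂μ, c x (T x) - V (T x) = cTransform c V x := by
  classical
  have hc' : ∀ x, Continuous (c x) := fun x => hc.comp (Continuous.prodMk_right x)
  choose S hS using exists_eq_cTransform hc' V
  obtain ⟨N, hN, hNm, hN0⟩ := exists_measurable_superset_of_null (ae_iff.1 huniq)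
  -- Off the null set `N` minimizers are unique, so any selection restricted to `Nᶜ` is continuous;
  -- on `N` a constant keeps the map measurable.
  refine ⟨N.piecewise (fun _ => Classical.arbitrary Y) S, ?_, ?_⟩
  · refine measurable_of_restrict_of_restrict_compl hNm ?_ ?_
    · rw [domRestrict_piecewise]
      exact measurable_const
    · rw [domRestrict_piecewise_compl]
      refine Continuous.measurable (continuous_iff_continuousAt.2 fun x => ?_)
      refine tendsto_of_tendsto_cTransform hc (V := V) (x := fun z : ↥Nᶜ => (z : X))
        continuous_subtype_val.continuousAt ?_ fun y hy => ?_
      · simp only [domRestrict_apply, hS]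
        exact ((continuous_cTransform hc V).comp continuous_subtype_val).continuousAt
      · exact not_not.1 (fun h => x.2 (hN h)) hy (hS x)
  · filter_upwards [compl_mem_ae_iff.2 hN0] with x hx
    rw [piecewise_eq_of_notMem _ _ _ hx]
    exact hS x

end Transform

/-! ### The semi-dual functional: maximizers and optimality -/

/-- The semi-dual functional `∫ V^c dμ + ∫ V dν`. -/
noncomputable def semiDual {X Y : Type*} [MeasurableSpace X] [TopologicalSpace Y] [MeasurableSpace Y]
    (c : X → Y → ℝ) (μ : Measure X) (ν : Measure Y) (V : C(Y, ℝ)) : ℝ :=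
  (∫ x, cTransform c V x ∂μ) + ∫ y, V y ∂ν

theorem snotObjective_eq_semiDual {X Y : Type*} [MeasurableSpace X] [TopologicalSpace Y]
    [MeasurableSpace Y] {c : X → Y → ℝ} {μ : Measure X} {ν : Measure Y} {V : C(Y, ℝ)} {T : X → Y}
    (h : ∀ᵐ x ∂μ, c x (T x) - V (T x) = cTransform c V x) :
    snotObjective c μ ν V T = semiDual c μ ν V := by
  rw [snotObjective, semiDual, integral_congr_ae h]

/-- Arzelà–Ascoli: pinning the value at `y₀` turns the Lipschitz bound into a pointwise bound.
Maximizers are sought in this set. -/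
theorem isCompact_lipschitz_normalized {Y : Type*} [PseudoMetricSpace Y] [CompactSpace Y] (L : NNReal) (y₀ : Y) :
    IsCompact {V : C(Y, ℝ) | LipschitzWith L V ∧ V y₀ = 0} := by
  refine ArzelaAscoli.isCompact_of_equicontinuous _ ?_
    (LipschitzWith.uniformEquicontinuous _ L fun V => V.2.1).equicontinuous
  have himg : ContinuousMap.toFun '' {V : C(Y, ℝ) | LipschitzWith L V ∧ V y₀ = 0} =
      {f : Y → ℝ | LipschitzWith L f ∧ f y₀ = 0} := by
    ext f
    constructor
    · rintro ⟨V, hV, rfl⟩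
      exact hV
    · intro hf
      exact ⟨⟨f, hf.1.continuous⟩, hf, rfl⟩
  rw [himg]
  refine (isCompact_univ_pi fun y => isCompact_Icc (a := -(L * dist y y₀))
    (b := L * dist y y₀)).of_isClosed_subset ?_ fun f hf y _ => ?_
  · refine IsClosed.inter (s₁ := {f : Y → ℝ | LipschitzWith L f}) ?_ (isClosed_eq (continuous_apply y₀) continuous_const)
    simp only [lipschitzWith_iff_dist_le_mul, ofPred_forall]
    exact isClosed_iInter fun y => isClosed_iInter fun z => isClosed_le
      (Continuous.dist (continuous_apply (A := fun _ => ℝ) y) (continuous_apply z))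
      continuous_const
  · have := hf.1.dist_le_mul y y₀
    rw [hf.2, Real.dist_eq, sub_zero] at this
    exact abs_le.1 this

section SemiDualProblem

variable {X Y : Type*} [TopologicalSpace X] [CompactSpace X] [MeasurableSpace X]
  [OpensMeasurableSpace X] [MetricSpace Y] [CompactSpace Y] [MeasurableSpace Y]
  [BorelSpace Y] {c : X → Y → ℝ} {μ : Measure X} {ν : Measure Y}

theorem integrable_of_continuous [IsFiniteMeasure μ] {f : X → ℝ} (hf : Continuous f) :
    Integrable f μ := by
  obtain ⟨C, hC⟩ := isCompact_univ.exists_bound_of_continuousOn hf.continuousOn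
  exact .of_bound hf.measurable.aestronglyMeasurable C (ae_of_all _ fun x => hC x (mem_univ x))

theorem integrable_comp_graph [IsFiniteMeasure μ] {g : X × Y → ℝ} (hg : Continuous g) {T : X → Y}
    (hT : Measurable T) : Integrable (fun x => g (x, T x)) μ := by
  obtain ⟨C, hC⟩ := isCompact_univ.exists_bound_of_continuousOn hg.continuousOn
  exact .of_bound (hg.measurable.comp (measurable_id.prodMk hT)).aestronglyMeasurable C
    (ae_of_all _ fun x => hC _ (mem_univ _))

theorem integrable_cost [IsFiniteMeasure μ] (hc : Continuous (Function.uncurry c)) {T : X → Y}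
    (hT : Measurable T) : Integrable (fun x => c x (T x)) μ :=
  integrable_comp_graph hc hT

theorem integrable_potential_comp [IsFiniteMeasure μ] (V : C(Y, ℝ)) {T : X → Y}
    (hT : Measurable T) : Integrable (fun x => V (T x)) μ :=
  integrable_comp_graph (g := fun p : X × Y => V p.2) (V.continuous.comp continuous_snd) hT

theorem integrable_cost_sub [IsFiniteMeasure μ] (hc : Continuous (Function.uncurry c))
    (V : C(Y, ℝ)) {T : X → Y} (hT : Measurable T) :
    Integrable (fun x => c x (T x) - V (T x)) μ :=
  (integrable_cost hc hT).sub (integrable_potential_comp V hT)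

theorem semiDual_le_snotObjective [IsFiniteMeasure μ] (hc : Continuous (Function.uncurry c))
    (V : C(Y, ℝ)) {T : X → Y} (hT : Measurable T) :
    semiDual c μ ν V ≤ snotObjective c μ ν V T := by
  refine add_le_add_left (integral_mono (integrable_of_continuous (continuous_cTransform hc V))
    (integrable_cost_sub hc V hT) fun x => ?_) _
  exact cTransform_le (fun x => hc.comp (Continuous.prodMk_right x)) V x (T x)

/-- The integrand dominates `V^c` everywhere, so equal integrals leave no room for a strict gap on a
set of positive measure. -/
theorem ae_eq_cTransform_of_integral_le [IsFiniteMeasure μ]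
    (hc : Continuous (Function.uncurry c)) {V : C(Y, ℝ)} {T : X → Y} (hT : Measurable T)
    (h : ∫ x, (c x (T x) - V (T x)) ∂μ ≤ ∫ x, cTransform c V x ∂μ) :
    ∀ᵐ x ∂μ, c x (T x) - V (T x) = cTransform c V x := by
  have hle : ∀ x, cTransform c V x ≤ c x (T x) - V (T x) := fun x =>
    cTransform_le (fun x => hc.comp (Continuous.prodMk_right x)) V x (T x)
  have hi := integrable_of_continuous (μ := μ) (continuous_cTransform hc V)
  have hi' := integrable_cost_sub (μ := μ) hc V hT
  have := (integral_eq_iff_of_ae_le hi hi' (ae_of_all _ hle)).1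
    (le_antisymm (integral_mono hi hi' hle) h)
  exact this.symm

theorem integral_cost_sub_potential [IsFiniteMeasure μ] (hc : Continuous (Function.uncurry c))
    (V : C(Y, ℝ)) {S : X → Y} (hS : MeasurePreserving S μ ν) :
    ∫ x, (c x (S x) - V (S x)) ∂μ = (∫ x, c x (S x) ∂μ) - ∫ y, V y ∂ν := by
  rw [integral_sub (integrable_cost hc hS.measurable) (integrable_potential_comp V hS.measurable),
    ← hS.map_eq, integral_map hS.measurable.aemeasurable
      V.continuous.measurable.aestronglyMeasurable]

theorem isOptimalTransportMap_of_eq_cTransform [IsFiniteMeasure μ]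
    (hc : Continuous (Function.uncurry c)) {V : C(Y, ℝ)} {T : X → Y}
    (hT : MeasurePreserving T μ ν) (hTV : ∀ᵐ x ∂μ, c x (T x) - V (T x) = cTransform c V x) :
    IsOptimalTransportMap c μ ν T := by
  refine ⟨hT, fun S hS => ?_⟩
  have h := semiDual_le_snotObjective (ν := ν) hc V hS.measurable (μ := μ)
  rw [← snotObjective_eq_semiDual hTV, snotObjective, snotObjective,
    integral_cost_sub_potential hc V hT, integral_cost_sub_potential hc V hS] at h
  linarith

/-- Complementary slackness: among maps pushing `μ` to `ν` the term `∫ V ∘ S dμ` is always `∫ V dν`,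
so minimal cost means minimal `∫ (c - V)`. -/
theorem IsOptimalTransportMap.ae_eq_cTransform [IsFiniteMeasure μ]
    (hc : Continuous (Function.uncurry c)) {V : C(Y, ℝ)} {S T : X → Y}
    (hS : IsOptimalTransportMap c μ ν S) (hT : MeasurePreserving T μ ν)
    (hTV : ∀ᵐ x ∂μ, c x (T x) - V (T x) = cTransform c V x) :
    ∀ᵐ x ∂μ, c x (S x) - V (S x) = cTransform c V x := by
  refine ae_eq_cTransform_of_integral_le hc hS.1.measurable ?_
  rw [← integral_congr_ae hTV, integral_cost_sub_potential hc V hS.1,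
    integral_cost_sub_potential hc V hT]
  exact sub_le_sub_right (hS.2 T hT) _

variable [Nonempty Y]

theorem snotInnerValue_eq_semiDual [IsFiniteMeasure μ] (hc : Continuous (Function.uncurry c))
    {V : C(Y, ℝ)} (huniq : ∀ᵐ x ∂μ, {y | c x y - V y = cTransform c V x}.Subsingleton) :
    snotInnerValue c μ ν V = semiDual c μ ν V := by
  obtain ⟨T, hT, hTV⟩ := exists_measurable_eq_cTransform hc V huniq
  refine le_antisymm ?_ (le_iInf₂ fun S hS =>
    EReal.coe_le_coe_iff.2 (semiDual_le_snotObjective hc V hS))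
  rw [← snotObjective_eq_semiDual hTV]
  exact iInf₂_le T hT

theorem continuous_semiDual [IsFiniteMeasure μ] [IsFiniteMeasure ν]
    (hc : Continuous (Function.uncurry c)) : Continuous (semiDual c μ ν) := by
  have hc' : ∀ x, Continuous (c x) := fun x => hc.comp (Continuous.prodMk_right x)
  refine Continuous.add ?_ ?_
  · refine (LipschitzWith.of_dist_le_mul (K := (μ.real univ).toNNReal) fun V W => ?_).continuous
    rw [Real.dist_eq, ← integral_sub (integrable_of_continuous (continuous_cTransform hc V))
      (integrable_of_continuous (continuous_cTransform hc W)), Real.coe_toNNReal _ measureReal_nonneg,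
      dist_eq_norm, mul_comm]
    exact norm_integral_le_of_norm_le_const (ae_of_all _ fun x => (Real.norm_eq_abs _).le.trans
      (abs_cTransform_sub_le hc' V W x))
  · refine (LipschitzWith.of_dist_le_mul (K := (ν.real univ).toNNReal) fun V W => ?_).continuous
    rw [Real.dist_eq, ← integral_sub (integrable_of_continuous V.continuous)
      (integrable_of_continuous W.continuous), Real.coe_toNNReal _ measureReal_nonneg,
      dist_eq_norm, mul_comm]
    exact norm_integral_le_of_norm_le_const (ae_of_all _ fun y => (V - W).norm_coe_le_norm y)

/-- Replacing a potential by its double transform, normalized at `y₀`, does not decrease the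
semi-dual functional. -/
theorem exists_lipschitz_semiDual_le [IsProbabilityMeasure μ] [IsProbabilityMeasure ν]
    (hc : Continuous (Function.uncurry c)) {L : NNReal} (hL : ∀ x, LipschitzWith L (c x))
    (y₀ : Y) (V : C(Y, ℝ)) :
    ∃ W : C(Y, ℝ), (LipschitzWith L W ∧ W y₀ = 0) ∧ semiDual c μ ν V ≤ semiDual c μ ν W := by
  have hc' : ∀ x, Continuous (c x) := fun x => hc.comp (Continuous.prodMk_right x)
  have : Nonempty X := nonempty_of_isProbabilityMeasure μ
  have hb : ∀ y : Y, Continuous fun x => c x y := fun y => hc.comp (Continuous.prodMk_left y)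
  set φ : C(X, ℝ) := ⟨cTransform c V, continuous_cTransform hc V⟩ with hφ
  set W₀ : Y → ℝ := cTransform (fun y x => c x y) φ with hW₀
  have hle : ∀ y x, W₀ y ≤ c x y - cTransform c V x := cTransform_le hb φ
  have hex : ∀ y, ∃ x, c x y - cTransform c V x = W₀ y := exists_eq_cTransform hb φ
  have hlip : LipschitzWith L W₀ := by
    refine LipschitzWith.of_le_add_mul L fun y z => ?_
    obtain ⟨x, hx⟩ := hex z
    have h₁ := hle y x
    have h₂ := (abs_le.1 ((hL x).dist_le_mul y z)).2
    linarith
  have hVW : ∀ y, V y ≤ W₀ y := fun y => by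
    obtain ⟨x, hx⟩ := hex y
    have := cTransform_le hc' V x y
    linarith
  let W : C(Y, ℝ) := ⟨fun y => W₀ y - W₀ y₀, hlip.continuous.sub continuous_const⟩
  refine ⟨W, ⟨?_, sub_self _⟩, ?_⟩
  · refine LipschitzWith.of_dist_le_mul fun y z => ?_
    rw [show dist (W y) (W z) = dist (W₀ y) (W₀ z) from dist_sub_right _ _ _]
    exact hlip.dist_le_mul y z
  -- Subtracting `W₀ y₀` costs that amount in the `ν` term and regains it in the `μ` term, since
  -- both masses are 1.
  · have hφW : ∀ x, cTransform c V x + W₀ y₀ ≤ cTransform c W x := fun x => by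
      obtain ⟨y, hy⟩ := exists_eq_cTransform hc' W x
      have h₁ := hle y x
      have h₂ : W y = W₀ y - W₀ y₀ := rfl
      linarith
    have hi := integrable_of_continuous (μ := μ) (continuous_cTransform hc V)
    have h₁ : (∫ x, cTransform c V x ∂μ) + W₀ y₀ ≤ ∫ x, cTransform c W x ∂μ := by
      have := integral_mono (hi.add (integrable_const (W₀ y₀)))
        (integrable_of_continuous (μ := μ) (continuous_cTransform hc W)) hφW
      simpa [integral_add hi (integrable_const _)] using this
    have h₂ : (∫ y, V y ∂ν) - W₀ y₀ ≤ ∫ y, W y ∂ν := by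
      have hiV := integrable_of_continuous (μ := ν) V.continuous
      have := integral_mono (hiV.sub (integrable_const (W₀ y₀)))
        (integrable_of_continuous (μ := ν) W.continuous) fun y => sub_le_sub_right (hVW y) (W₀ y₀)
      simpa [integral_sub hiV (integrable_const _)] using this
    unfold semiDual
    linarith

theorem exists_forall_semiDual_le [IsProbabilityMeasure μ] [IsProbabilityMeasure ν]
    (hc : Continuous (Function.uncurry c)) {L : NNReal} (hL : ∀ x, LipschitzWith L (c x)) :
    ∃ V : C(Y, ℝ), ∀ W, semiDual c μ ν W ≤ semiDual c μ ν V := by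
  obtain ⟨y₀⟩ := ‹Nonempty Y›
  obtain ⟨V, -, hV⟩ := (isCompact_lipschitz_normalized L y₀).exists_isMaxOn
    ⟨0, LipschitzWith.const' 0, rfl⟩ (continuous_semiDual (μ := μ) (ν := ν) hc).continuousOn
  refine ⟨V, fun W => ?_⟩
  obtain ⟨W', hW', hle⟩ := exists_lipschitz_semiDual_le (μ := μ) (ν := ν) hc hL y₀ W
  exact hle.trans (hV hW')

/-- First variation of the semi-dual functional at a maximizer. -/
theorem integral_le_integral_comp_of_forall_semiDual_le [IsFiniteMeasure μ] [IsFiniteMeasure ν]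
    (hc : Continuous (Function.uncurry c))
    (huniq : ∀ V : C(Y, ℝ), ∀ᵐ x ∂μ, {y | c x y - V y = cTransform c V x}.Subsingleton)
    {V : C(Y, ℝ)} (hV : ∀ W, semiDual c μ ν W ≤ semiDual c μ ν V) {T : X → Y}
    (hTV : ∀ᵐ x ∂μ, c x (T x) - V (T x) = cTransform c V x) (f : C(Y, ℝ)) :
    ∫ y, f y ∂ν ≤ ∫ x, f (T x) ∂μ := by
  have hc' : ∀ x, Continuous (c x) := fun x => hc.comp (Continuous.prodMk_right x)
  let ε : ℕ → ℝ := fun n => 1 / ((n : ℝ) + 1)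
  have hε : Tendsto ε atTop (𝓝 0) := tendsto_one_div_add_atTop_nhds_zero_nat
  have hεpos : ∀ n, 0 < ε n := fun n => Nat.one_div_pos_of_nat
  choose S hS hSV using fun n => exists_measurable_eq_cTransform hc (V + ε n • f)
    (huniq (V + ε n • f))
  have hle : ∀ n, ∫ y, f y ∂ν ≤ ∫ x, f (S n x) ∂μ := fun n => by
    have hif := integrable_potential_comp (μ := μ) f (hS n)
    -- The minimizer `S n x` for the perturbed potential is a competitor in the infimum defining
    -- `V^c(x)`.
    have h₁ : (∫ x, cTransform c V x ∂μ) - ε n * ∫ x, f (S n x) ∂μ ≤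
        ∫ x, cTransform c (V + ε n • f) x ∂μ := by
      rw [← integral_const_mul, ← integral_sub
        (integrable_of_continuous (continuous_cTransform hc V)) (hif.const_mul _)]
      refine integral_mono_ae ((integrable_of_continuous (continuous_cTransform hc V)).sub
        (hif.const_mul _)) (integrable_of_continuous (continuous_cTransform hc _)) ?_
      filter_upwards [hSV n] with x hx
      have := cTransform_le hc' V x (S n x)
      rw [← hx]
      simp only [ContinuousMap.add_apply, ContinuousMap.smul_apply, smul_eq_mul]
      linarith
    have h₂ : ∫ y, (V + ε n • f) y ∂ν = (∫ y, V y ∂ν) + ε n * ∫ y, f y ∂ν := by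
      rw [← integral_const_mul, ← integral_add (integrable_of_continuous V.continuous)
        ((integrable_of_continuous f.continuous).const_mul _)]
      rfl
    have h₃ := hV (V + ε n • f)
    simp only [semiDual] at h₃
    rw [h₂] at h₃
    exact le_of_mul_le_mul_left (by linarith) (hεpos n)
  -- Uniqueness at `V` gives `S n → T` a.e. as `ε n → 0`; dominated convergence passes to the limit.
  refine ge_of_tendsto' (tendsto_integral_of_dominated_convergence (fun _ => ‖f‖)
    (fun n => (integrable_potential_comp f (hS n)).aestronglyMeasurable) (integrable_const _)
    (fun n => ae_of_all _ fun x => f.norm_coe_le_norm _) ?_) hle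
  filter_upwards [ae_all_iff.2 hSV, huniq V, hTV] with x hSx hx hTx
  refine (f.continuous.tendsto _).comp (tendsto_of_tendsto_cTransform hc (V := V)
    (x := fun _ => x) tendsto_const_nhds ?_ fun y hy => hx hy hTx)
  have h₁ : Tendsto (fun n => V + ε n • f) atTop (𝓝 V) := by
    simpa using tendsto_const_nhds.add (hε.smul_const f)
  have h₂ : Tendsto (fun n => cTransform c (V + ε n • f) x) atTop (𝓝 (cTransform c V x)) := by
    refine tendsto_iff_dist_tendsto_zero.2 (squeeze_zero (fun _ => dist_nonneg)
      (fun n => abs_cTransform_sub_le hc' _ _ x) ?_)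
    simpa only [dist_eq_norm] using tendsto_iff_dist_tendsto_zero.1 h₁
  have h₃ : Tendsto (fun n => ε n * f (S n x)) atTop (𝓝 0) := by
    refine squeeze_zero_norm (fun n => ?_) (by simpa using hε.mul_const ‖f‖)
    rw [norm_mul, Real.norm_of_nonneg (hεpos n).le]
    exact mul_le_mul_of_nonneg_left (f.norm_coe_le_norm _) (hεpos n).le
  have h₄ := h₂.add h₃
  rw [add_zero] at h₄
  refine h₄.congr fun n => ?_
  rw [← hSx n]
  simp only [ContinuousMap.add_apply, ContinuousMap.smul_apply, smul_eq_mul]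
  ring

theorem measurePreserving_of_forall_semiDual_le [IsFiniteMeasure μ] [IsFiniteMeasure ν]
    (hc : Continuous (Function.uncurry c))
    (huniq : ∀ V : C(Y, ℝ), ∀ᵐ x ∂μ, {y | c x y - V y = cTransform c V x}.Subsingleton)
    {V : C(Y, ℝ)} (hV : ∀ W, semiDual c μ ν W ≤ semiDual c μ ν V) {T : X → Y} (hT : Measurable T)
    (hTV : ∀ᵐ x ∂μ, c x (T x) - V (T x) = cTransform c V x) : MeasurePreserving T μ ν := by
  refine ⟨hT, ext_of_forall_integral_eq_of_IsFiniteMeasure fun f => ?_⟩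
  rw [integral_map hT.aemeasurable f.continuous.measurable.aestronglyMeasurable]
  have h₁ := integral_le_integral_comp_of_forall_semiDual_le hc huniq hV hTV f.toContinuousMap
  -- The one-sided inequality is linear in `f`, so `-f` supplies the reverse.
  have h₂ := integral_le_integral_comp_of_forall_semiDual_le hc huniq hV hTV (-f.toContinuousMap)
  simp only [ContinuousMap.neg_apply, integral_neg] at h₂
  exact le_antisymm (neg_le_neg_iff.1 h₂) h₁

/-- If the minimizers of `c(x, ·) - V` are almost everywhere unique for every potential `V`, the
Monge problem has an almost everywhere unique solution, and every optimal max-min pair recovers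
it. -/
theorem exists_isOptimalTransportMap_and_ae_eq [IsProbabilityMeasure μ] [IsProbabilityMeasure ν]
    (hc : Continuous (Function.uncurry c)) {L : NNReal} (hL : ∀ x, LipschitzWith L (c x))
    (huniq : ∀ V : C(Y, ℝ), ∀ᵐ x ∂μ, {y | c x y - V y = cTransform c V x}.Subsingleton) :
    ∃ Topt : X → Y, IsOptimalTransportMap c μ ν Topt ∧
      (∀ T : X → Y, IsOptimalTransportMap c μ ν T → T =ᵐ[μ] Topt) ∧
      (∀ (V : C(Y, ℝ)) (Trec : X → Y),
        IsOptimalMaxMinPair c μ ν V Trec → Trec =ᵐ[μ] Topt) := by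
  obtain ⟨V, hV⟩ := exists_forall_semiDual_le (μ := μ) (ν := ν) hc hL
  obtain ⟨T, hT, hTV⟩ := exists_measurable_eq_cTransform hc V (huniq V)
  have hTp := measurePreserving_of_forall_semiDual_le hc huniq hV hT hTV
  have hunique : ∀ S : X → Y, IsOptimalTransportMap c μ ν S → S =ᵐ[μ] T := fun S hS => by
    filter_upwards [hS.ae_eq_cTransform hc hTp hTV, hTV, huniq V] with x hSx hTx hx
    exact hx hSx hTx
  refine ⟨T, isOptimalTransportMap_of_eq_cTransform hc hTp hTV, hunique, ?_⟩
  rintro U S ⟨hU, hS, hSmin⟩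
  simp only [snotInnerValue_eq_semiDual hc (huniq _), EReal.coe_le_coe_iff] at hU
  obtain ⟨R, hR, hRU⟩ := exists_measurable_eq_cTransform hc U (huniq U)
  have hSU : ∀ᵐ x ∂μ, c x (S x) - U (S x) = cTransform c U x := by
    refine ae_eq_cTransform_of_integral_le hc hS ?_
    have := hSmin R hR
    rw [snotObjective_eq_semiDual hRU, snotObjective, semiDual] at this
    exact le_of_add_le_add_right this
  exact hunique S (isOptimalTransportMap_of_eq_cTransform hc
    (measurePreserving_of_forall_semiDual_le hc huniq hU hS hSU) hSU)

end SemiDualProblem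

/-! ### Strictly convex difference costs: a.e. unique minimizers -/

section DifferenceCost

variable {E : Type*} [NormedAddCommGroup E] [NormedSpace ℝ E]

/-- A strictly convex function has distinct derivatives at distinct points. -/
theorem StrictConvexOn.eq_of_hasFDerivAt {h : E → ℝ} (hconv : StrictConvexOn ℝ univ h)
    {p : E →L[ℝ] ℝ} {a b : E} (ha : HasFDerivAt h p a) (hb : HasFDerivAt h p b) : a = b := by
  by_contra hab
  have hline : ∀ t : ℝ, HasDerivAt (AffineMap.lineMap a b : ℝ → E) (b - a) t := fun t =>
    AffineMap.hasDerivAt_lineMap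
  have hg : StrictConvexOn ℝ univ fun t : ℝ => h (AffineMap.lineMap a b t) := by
    refine ⟨convex_univ, fun s _ t _ hst α β hα hβ hαβ => ?_⟩
    have hne : AffineMap.lineMap a b s ≠ (AffineMap.lineMap a b t : E) := fun heq =>
      hst (AffineMap.lineMap_injective ℝ hab heq)
    have := hconv.2 (mem_univ _) (mem_univ _) hne hα hβ hαβ
    rwa [← Convex.combo_affine_apply hαβ] at this
  have h₀ : HasDerivAt (fun t : ℝ => h (AffineMap.lineMap a b t)) (p (b - a)) 0 :=
    HasFDerivAt.comp_hasDerivAt _ (by simpa using ha) (hline 0)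
  have h₁ : HasDerivAt (fun t : ℝ => h (AffineMap.lineMap a b t)) (p (b - a)) 1 :=
    HasFDerivAt.comp_hasDerivAt _ (by simpa using hb) (hline 1)
  -- The slope over `[0, 1]` would lie strictly between the two end derivatives, both equal to `p (b
  -- - a)`.
  exact (hg.lt_slope_of_hasDerivAt (mem_univ _) (mem_univ _) zero_lt_one h₀).not_gt
    (hg.slope_lt_of_hasDerivAt (mem_univ _) (mem_univ _) zero_lt_one h₁)

theorem ContDiff.exists_lipschitzOnWith_closedBall [FiniteDimensional ℝ E] {h : E → ℝ}
    (hC1 : ContDiff ℝ 1 h) (R : ℝ) :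
    ∃ L : NNReal, LipschitzOnWith L h (Metric.closedBall 0 R) := by
  have : ProperSpace E := FiniteDimensional.proper_real E
  obtain ⟨C, hC⟩ := (isCompact_closedBall (0 : E) R).exists_bound_of_continuousOn
    (hC1.continuous_fderiv one_ne_zero).continuousOn
  refine ⟨C.toNNReal, (convex_closedBall 0 R).lipschitzOnWith_of_nnnorm_fderiv_le
    (fun x _ => hC1.differentiable one_ne_zero x) fun x hx => ?_⟩
  exact NNReal.coe_le_coe.1 ((hC x hx).trans (Real.le_coe_toNNReal C))

variable {Y : Type*} [TopologicalSpace Y] [CompactSpace Y]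

theorem lipschitzOnWith_cTransform [Nonempty Y] {X : Type*} [PseudoMetricSpace X] {c : X → Y → ℝ}
    (hc : ∀ x, Continuous (c x)) (V : C(Y, ℝ)) {s : Set X} {L : NNReal}
    (hL : ∀ y, LipschitzOnWith L (fun x => c x y) s) : LipschitzOnWith L (cTransform c V) s := by
  refine LipschitzOnWith.of_le_add_mul L fun x hx z hz => ?_
  obtain ⟨y, hy⟩ := exists_eq_cTransform hc V z
  have h₁ := cTransform_le hc V x y
  have h₂ := (abs_le.1 ((hL y).dist_le_mul x hx z hz)).2
  linarith

/-- For a minimizer `y`, the function `h(· - e y) - V y` touches the transform from above at `x`, so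
the two derivatives agree there. -/
theorem HasFDerivAt.of_eq_cTransform {h : E → ℝ} (hd : Differentiable ℝ h) {e : Y → E}
    (he : Continuous e) {V : C(Y, ℝ)} {x : E} {p : E →L[ℝ] ℝ}
    (hp : HasFDerivAt (cTransform (fun z y => h (z - e y)) V) p x) {y : Y}
    (hy : h (x - e y) - V y = cTransform (fun z y => h (z - e y)) V x) :
    HasFDerivAt h p (x - e y) := by
  have hc : ∀ z, Continuous fun y => h (z - e y) := fun z =>
    hd.continuous.comp (continuous_const.sub he)
  have h₁ : HasFDerivAt (fun z => h (z - e y)) (fderiv ℝ h (x - e y)) x :=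
    (hasFDerivAt_comp_sub _).2 (hd (x - e y)).hasFDerivAt
  have hmin : IsLocalMin (fun z => h (z - e y) - cTransform (fun z y => h (z - e y)) V z) x :=
    Eventually.of_forall fun z => by
      have := cTransform_le hc V z y
      linarith
  have h₂ := hmin.hasFDerivAt_eq_zero (h₁.sub hp)
  rw [← sub_eq_zero.1 h₂]
  exact (hd (x - e y)).hasFDerivAt

/-- For a strictly convex `C¹` cost `h(x - y)`, the minimizers of `y ↦ h(x - y) - V(y)` are unique
for almost every `x`. -/
theorem ae_eq_of_eq_cTransform [Nonempty Y] [FiniteDimensional ℝ E] [MeasurableSpace E] [BorelSpace E]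
    (m : Measure E) [m.IsAddHaarMeasure] {h : E → ℝ} (hC1 : ContDiff ℝ 1 h)
    (hconv : StrictConvexOn ℝ univ h) {e : Y → E} (he : Continuous e) (V : C(Y, ℝ)) :
    ∀ᵐ x ∂m, ∀ y z, h (x - e y) - V y = cTransform (fun z y => h (z - e y)) V x →
      h (x - e z) - V z = cTransform (fun z y => h (z - e y)) V x → e y = e z := by
  have hc : ∀ z, Continuous fun y => h (z - e y) := fun z =>
    hC1.continuous.comp (continuous_const.sub he)
  obtain ⟨C, hC⟩ := isCompact_univ.exists_bound_of_continuousOn he.continuousOn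
  -- Rademacher on each ball: `C` bounds `e`, so all arguments `x - e y` stay in the ball of radius
  -- `n + C`, where `h` is Lipschitz.
  have hdiff : ∀ n : ℕ, ∀ᵐ x ∂m, x ∈ Metric.ball (0 : E) n →
      DifferentiableAt ℝ (cTransform (fun z y => h (z - e y)) V) x := fun n => by
    obtain ⟨L, hL⟩ := hC1.exists_lipschitzOnWith_closedBall (n + C)
    have hlip := lipschitzOnWith_cTransform (s := Metric.ball 0 n) hc V (L := L) fun y => by
      refine LipschitzOnWith.of_dist_le_mul fun x hx z hz => ?_
      have hmem : ∀ w ∈ Metric.ball (0 : E) n, w - e y ∈ Metric.closedBall (0 : E) (n + C) := by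
        intro w hw
        rw [mem_closedBall_zero_iff]
        exact (norm_sub_le _ _).trans
          (add_le_add (mem_ball_zero_iff.1 hw).le (hC y (mem_univ y)))
      simpa using hL.dist_le_mul _ (hmem x hx) _ (hmem z hz)
    filter_upwards [hlip.ae_differentiableWithinAt_of_mem (μ := m)] with x hx hxn
    exact (hx hxn).differentiableAt (Metric.isOpen_ball.mem_nhds hxn)
  filter_upwards [ae_all_iff.2 hdiff] with x hx y z hy hz
  obtain ⟨n, hn⟩ := exists_nat_gt ‖x‖
  have hp := (hx n (mem_ball_zero_iff.2 hn)).hasFDerivAt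
  have hd := hC1.differentiable one_ne_zero
  exact sub_right_injective (hconv.eq_of_hasFDerivAt (hp.of_eq_cTransform hd he hy)
    (hp.of_eq_cTransform hd he hz))

end DifferenceCost

/-! ### Specialization to compact subsets of Euclidean space -/

theorem mainTheorem9 (d : ℕ) (X Y K : Set (EuclideanSpace ℝ (Fin d)))
    (hX : IsCompact X) (hY : IsCompact Y) (hK : IsCompact K)
    (μ : Measure X) [IsProbabilityMeasure μ] (ν : Measure Y) [IsProbabilityMeasure ν]
    (hμK : μ.map Subtype.val Kᶜ = 0)
    (hμfrontier : μ.map Subtype.val (frontier K) = 0)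
    (hμac : μ.map Subtype.val ≪ (volume : Measure (EuclideanSpace ℝ (Fin d))))
    (h : EuclideanSpace ℝ (Fin d) → ℝ) (hC1 : ContDiff ℝ 1 h)
    (hconv : StrictConvexOn ℝ Set.univ h) :
    ∃ Topt : X → Y,
      IsOptimalTransportMap (diffCost h X Y) μ ν Topt ∧
      (∀ T : X → Y, IsOptimalTransportMap (diffCost h X Y) μ ν T → T =ᵐ[μ] Topt) ∧
      (∀ (V : C(Y, ℝ)) (Trec : X → Y),
        IsOptimalMaxMinPair (diffCost h X Y) μ ν V Trec → Trec =ᵐ[μ] Topt) := by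
  have : CompactSpace X := isCompact_iff_compactSpace.1 hX
  have : CompactSpace Y := isCompact_iff_compactSpace.1 hY
  have : Nonempty Y := nonempty_of_isProbabilityMeasure ν
  have hc : Continuous (Function.uncurry (diffCost h X Y)) :=
    hC1.continuous.comp ((continuous_subtype_val.comp continuous_fst).sub
      (continuous_subtype_val.comp continuous_snd))
  obtain ⟨A, hA⟩ := hX.exists_bound_of_continuousOn continuousOn_id
  obtain ⟨B, hB⟩ := hY.exists_bound_of_continuousOn continuousOn_id
  obtain ⟨L, hL⟩ := hC1.exists_lipschitzOnWith_closedBall (A + B)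
  refine exists_isOptimalTransportMap_and_ae_eq hc (L := L) (fun x => ?_) fun V => ?_
  · refine LipschitzWith.of_dist_le_mul fun y z => ?_
    have hmem : ∀ w : Y, (x : EuclideanSpace ℝ (Fin d)) - w ∈
        Metric.closedBall (0 : EuclideanSpace ℝ (Fin d)) (A + B) := fun w => by
      rw [mem_closedBall_zero_iff]
      exact (norm_sub_le _ _).trans (add_le_add (hA x x.2) (hB w w.2))
    have := hL.dist_le_mul _ (hmem y) _ (hmem z)
    rwa [dist_sub_left] at this
  -- The transform is taken on the whole space, where Rademacher applies; absolute continuity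
  -- carries the a.e. statement to `μ`.
  · have hae := hμac.ae_le (ae_eq_of_eq_cTransform volume hC1 hconv
      (continuous_subtype_val (p := (· ∈ Y))) V)
    filter_upwards [ae_of_ae_map measurable_subtype_coe.aemeasurable hae] with x hx y hy z hz
    exact Subtype.ext (hx y z hy hz)
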